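/- Let $d\ge 1$ be an integer and $p\in(0,1)$. For $n\ge 3$ consider the decomposition of the $d$-dimensional torus $(\mathbb{R}/n\mathbb{Z})^d$ into open unit cubes of dimensions $0,1,\dots,d$ with vertices at the lattice points; thus the open $d$-cubes are $(0,1)^d+z$, $z\in\{0,\dots,n-1\}^d$. Let $(X_z)_{z\in\{0,\dots,n-1\}^d}$ be independent random variables with $P(X_z=1)=p$ and $P(X_z=-1)=1-p$. The plaquette model is the random set $$\mathcal{P}=\bigcup_{z}\big(\partial[0,1]^d+z\big)\ \cup\bigcup_{z:\,X_z=1}\big((0,1)^d+z\big).$$ For $j\in\{0,\dots,d\}$ its $j$-th intrinsic volume is $$V_j(\mathcal{P})=\sum_{D\subseteq\mathcal{P}}(-1)^{\dim D-j}\binom{\dim D}{j},$$ the sum running over all open cubes $D$ (of all dimensions) of the decomposition that are contained in $\mathcal{P}$. Let $\mathbf{W}=(W_0,\dots,W_d)$ with $W_j=n^{-d/2}\big(V_j(\mathcal{P})-\mathbb{E}[V_j(\mathcal{P})]\big)$, and let $\mathbf{N}_\Sigma$ be a $(d+1)$-dimensional centred Gaussian random vector with covariance matrix $$\Sigma_{ij}=(-1)^{i+j}\binom{d}{i}\binom{d}{j}\,p(1-p),\qquad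 i,j\in\{0,\dots,d\}.$$ For random vectors $\mathbf{X},\mathbf{Y}$ in $\mathbb{R}^m$ put $d_4(\mathbf{X},\mathbf{Y})=\sup_g|\mathbb{E}[g(\mathbf{X})]-\mathbb{E}[g(\mathbf{Y})]|$, where $g$ runs over all four times partially differentiable functions $g:\mathbb{R}^m\to\mathbb{R}$ all of whose partial derivatives of the orders $1,2,3,4$ are bounded by $1$ in absolute value. Then there is a constant $C=C(p,d)$, depending only on $p$ and $d$, such that for all $n\ge 3$ $$d_4(\mathbf{W},\mathbf{N}_\Sigma)\le\frac{C}{n^{d/2}}.$$ -/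

import Mathlib

open MeasureTheory ProbabilityTheory
open scoped ENNReal

noncomputable section

namespace CubicalComplex

/-- The `d`-dimensional torus of side length `n`, i.e. the box `[0, n]^d` with opposite faces
identified. -/
abbrev Torus (d n : ℕ) : Type := Fin d → AddCircle (n : ℝ)

/-- The quotient map from `ℝ^d` onto the torus. -/
def toTorus (d n : ℕ) (x : Fin d → ℝ) : Torus d n := fun i => (x i : AddCircle (n : ℝ))

/-- The lattice point `z ∈ {0, …, n-1}^d`, as a point of `ℝ^d`. -/
def latticePoint {d n : ℕ} (z : Fin d → Fin n) : Fin d → ℝ := fun i => ((z i : ℕ) : ℝ)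

/-- The open cube with lower corner `z` and edges in the directions in `S`, as a subset of the
torus: coordinates in `S` range over `(z i, z i + 1)`, the others are equal to `z i`.
Its dimension is the cardinality of `S`. As `S` and `z` vary, each open cube of the lattice of
unit cubes on the torus occurs exactly once. -/
def openCube {d n : ℕ} (S : Finset (Fin d)) (z : Fin d → Fin n) : Set (Torus d n) :=
  toTorus d n '' {x | ∀ i, (i ∈ S → x i ∈ Set.Ioo (latticePoint z i) (latticePoint z i + 1)) ∧
    (i ∉ S → x i = latticePoint z i)}

/-- The boundary `∂[0,1]^d + z`, as a subset of the torus. -/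
def cubeBoundary {d n : ℕ} (z : Fin d → Fin n) : Set (Torus d n) :=
  toTorus d n '' frontier (Set.Icc (latticePoint z) (latticePoint z + 1))

/-- The plaquette model: the union of all the boundaries of the unit `d`-cubes, together with those
open `d`-cubes whose sign `x z` is equal to `1`. -/
def plaquette {d n : ℕ} (x : (Fin d → Fin n) → ℝ) : Set (Torus d n) :=
  (⋃ z, cubeBoundary z) ∪ ⋃ (z) (_ : x z = 1), openCube Finset.univ z

/-- The `j`-th intrinsic volume `(-1)^(δ-j) * (δ choose j)` of an open `δ`-cube
(it is `0` for `j > δ`). -/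
def openCubeVolume (j δ : ℕ) : ℝ := (-1) ^ (δ - j) * (δ.choose j : ℝ)

open Classical in
/-- The `j`-th intrinsic volume of a union `K` of open cubes of the lattice: the sum of the
`j`-th intrinsic volumes of all the open cubes (of all dimensions) that belong to `K`. -/
def intrinsicVolume {d n : ℕ} (j : ℕ) (K : Set (Torus d n)) : ℝ :=
  ∑ S : Finset (Fin d), ∑ z : Fin d → Fin n,
    if openCube S z ⊆ K then openCubeVolume j S.card else 0

/-- The vector with components `n^(-d/2) * (V_j - 𝔼[V_j])`, `j = 0, …, d`, where `V_j` is the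
`j`-th intrinsic volume of the plaquette model with random signs `X`. -/
def plaquetteVector {d n : ℕ} {Ω : Type*} [MeasurableSpace Ω] (P : Measure Ω)
    (X : (Fin d → Fin n) → Ω → ℝ) (ω : Ω) : EuclideanSpace ℝ (Fin (d + 1)) :=
  WithLp.toLp 2 fun j =>
    (n : ℝ) ^ (-(d : ℝ) / 2) *
      (intrinsicVolume (j : ℕ) (plaquette fun z => X z ω) -
        ∫ ω', intrinsicVolume (j : ℕ) (plaquette fun z => X z ω') ∂P)

/-- The covariance matrix with entries `(-1)^(i+j) (d choose i) (d choose j) p (1-p)`,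
`i, j = 0, …, d`. -/
def limitCovariance (d : ℕ) (p : ℝ) : Matrix (Fin (d + 1)) (Fin (d + 1)) ℝ :=
  Matrix.of fun i j =>
    (-1) ^ ((i : ℕ) + (j : ℕ)) * (d.choose i : ℝ) * (d.choose j : ℝ) * p * (1 - p)

/-- The matrix is positive semidefinite, hence the covariance matrix of a Gaussian law. -/
theorem limitCovariance_posSemidef (d : ℕ) {p : ℝ} (h0 : 0 < p) (h1 : p < 1) :
    (limitCovariance d p).PosSemidef := by
  have h : limitCovariance d p = (p * (1 - p)) •
      Matrix.vecMulVec (fun i : Fin (d + 1) => (-1 : ℝ) ^ (i : ℕ) * (d.choose i : ℝ))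
        (star fun i : Fin (d + 1) => (-1 : ℝ) ^ (i : ℕ) * (d.choose i : ℝ)) := by
    ext i j
    simp [limitCovariance, Matrix.vecMulVec_apply, pow_add]
    ring
  rw [h]
  exact (Matrix.posSemidef_vecMulVec_self_star _).smul (mul_nonneg h0.le (by linarith))

end CubicalComplex

/-- The partial derivative of `g` in the `i`-th coordinate direction. -/
def partialDeriv {m : ℕ} (i : Fin m) (g : EuclideanSpace ℝ (Fin m) → ℝ) :
    EuclideanSpace ℝ (Fin m) → ℝ :=
  fun x => lineDeriv ℝ g x (EuclideanSpace.single i 1)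

/-- The iterated partial derivative along a list of coordinate directions. -/
def iteratedPartialDeriv {m : ℕ} (l : List (Fin m)) (g : EuclideanSpace ℝ (Fin m) → ℝ) :
    EuclideanSpace ℝ (Fin m) → ℝ :=
  l.foldr partialDeriv g

/-- `g` is four times partially differentiable, and all its partial derivatives of the orders
`1, 2, 3, 4` are bounded by `1` in absolute value. -/
structure IsD4TestFunction {m : ℕ} (g : EuclideanSpace ℝ (Fin m) → ℝ) : Prop where
  partiallyDifferentiable : ∀ l : List (Fin m), l.length < 4 → ∀ (i : Fin m) x,
    LineDifferentiableAt ℝ (iteratedPartialDeriv l g) x (EuclideanSpace.single i 1)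
  bound : ∀ l : List (Fin m), 1 ≤ l.length → l.length ≤ 4 → ∀ x,
    |iteratedPartialDeriv l g x| ≤ 1

/-- The `d₄`-distance of two laws on `ℝ^m`. -/
def d4Dist {m : ℕ} (μ ν : Measure (EuclideanSpace ℝ (Fin m))) : ℝ≥0∞ :=
  ⨆ (g : EuclideanSpace ℝ (Fin m) → ℝ) (_ : IsD4TestFunction g),
    ENNReal.ofReal |(∫ x, g x ∂μ) - ∫ x, g x ∂ν|

end

/-!
The boundary of every unit cube belongs to the plaquette model, so all open cubes of dimension less
than `d` are always present and the only randomness in the `j`-th intrinsic volume is the number of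
open `d`-cubes present (`intrinsicVolume_plaquette`); such a cube is present exactly if its sign is
`1`, since its centre lies in no other piece of the model. Hence the vector `W` is `T • v`
for the fixed vector `v j = (-1) ^ (d - j) * (d choose j)` and the real random variable
`T = n ^ (-d/2) * ∑ z, (1_{X z = 1} - p)` (`plaquetteVector_eq_smul`). The covariance matrix
`limitCovariance d p` is `p (1 - p) v vᵀ`, so the Gaussian limit is the law of `Z • v` with
`Z ~ N(0, p (1 - p))` (`multivariateGaussian_limitCovariance`).

For a test function `g` it therefore suffices to compare the integrals of `f t = g (t • v)` against
the laws of `T` and `Z`. The bounds on the partial derivatives of `g` up to the third order make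
the partial derivatives of order at most two Lipschitz, hence `f` is twice differentiable with
Lipschitz second derivative (`IsD4TestFunction.hasLipschitzSecondDeriv`). Lindeberg's method
replaces the `n ^ d` summands of `T` by Gaussians of the same variance
(`HasLipschitzSecondDeriv.abs_integral_sum_sub_gaussianReal_le`); each replacement costs a constant
times the third absolute moments, of order `n ^ (-3d/2)`, which adds up to `n ^ (-d/2)`.
-/

/-! ### The cubes contained in the plaquette model -/

namespace CubicalComplex

theorem mem_frontier_Icc_pi_iff {d : ℕ} {a b x : Fin d → ℝ} :
    x ∈ frontier (Set.Icc a b) ↔ x ∈ Set.Icc a b ∧ ∃ i, x i = a i ∨ x i = b i := by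
  rw [isClosed_Icc.frontier_eq, ← Set.pi_univ_Icc, interior_pi_set Set.finite_univ]
  simp only [interior_Icc, Set.mem_sdiff, Set.mem_pi, Set.mem_univ, true_implies, Set.mem_Icc,
    Set.mem_Ioo, not_forall, not_and_or, not_lt]
  refine and_congr_right fun h => exists_congr fun i => or_congr ?_ ?_
  · exact ⟨fun h' => le_antisymm h' (h i).1, fun h' => h'.le⟩
  · exact ⟨fun h' => le_antisymm (h i).2 h', fun h' => h'.ge⟩

theorem exists_int_of_toTorus_eq {d n : ℕ} {x y : Fin d → ℝ}
    (h : toTorus d n x = toTorus d n y) (i : Fin d) : ∃ k : ℤ, x i = y i + k * n := by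
  have hi : ((x i : ℝ) : AddCircle (n : ℝ)) = (y i : ℝ) := congrFun h i
  rw [QuotientAddGroup.eq_iff_sub_mem, AddSubgroup.mem_zmultiples_iff] at hi
  obtain ⟨k, hk⟩ := hi
  refine ⟨k, ?_⟩
  rw [zsmul_eq_mul] at hk
  linarith

theorem openCube_subset_cubeBoundary {d n : ℕ} {S : Finset (Fin d)} (hS : S ≠ Finset.univ)
    (z : Fin d → Fin n) : openCube S z ⊆ cubeBoundary z := by
  obtain ⟨i, hi⟩ : ∃ i, i ∉ S := by
    by_contra! h
    exact hS (Finset.eq_univ_of_forall h)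
  refine Set.image_mono fun x hx => ?_
  rw [mem_frontier_Icc_pi_iff]
  refine ⟨⟨fun j => ?_, fun j => ?_⟩, i, Or.inl ((hx i).2 hi)⟩ <;> by_cases hj : j ∈ S
  · exact ((hx j).1 hj).1.le
  · exact ((hx j).2 hj).ge
  · exact ((hx j).1 hj).2.le
  · rw [(hx j).2 hj]
    simp

/-- The centre of an open `d`-cube has all its coordinates in `ℤ + 1/2`, so it lies on no cube
boundary and in no other open `d`-cube. -/
theorem openCube_univ_subset_plaquette_iff {d n : ℕ} {x : (Fin d → Fin n) → ℝ}
    {z : Fin d → Fin n} : openCube Finset.univ z ⊆ plaquette x ↔ x z = 1 := by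
  refine ⟨fun h => ?_, fun h => ?_⟩
  · have hc : toTorus d n (fun i => latticePoint z i + 1 / 2) ∈ openCube Finset.univ z :=
      ⟨_, fun i => ⟨fun _ => ⟨by linarith, by linarith⟩, fun hi => absurd (Finset.mem_univ i) hi⟩,
        rfl⟩
    rcases h hc with h | h
    · obtain ⟨w, y, hy, hyz⟩ := Set.mem_iUnion.1 h
      obtain ⟨-, i, hi⟩ := mem_frontier_Icc_pi_iff.1 hy
      obtain ⟨k, hk⟩ := exists_int_of_toTorus_eq hyz i
      exfalso
      simp only [latticePoint, Pi.add_apply, Pi.one_apply] at hi hk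
      -- Doubling turns the coincidence into an equation between an even and an odd integer.
      rcases hi with hi | hi
      · have : (2 * ((w i : ℕ) : ℤ)) = 2 * ((z i : ℕ) : ℤ) + 1 + 2 * (k * n) := by
          have : (2 * ((w i : ℕ) : ℝ)) = 2 * ((z i : ℕ) : ℝ) + 1 + 2 * (k * n) := by linarith
          exact_mod_cast this
        omega
      · have : (2 * ((w i : ℕ) : ℤ)) + 2 = 2 * ((z i : ℕ) : ℤ) + 1 + 2 * (k * n) := by
          have : (2 * ((w i : ℕ) : ℝ)) + 2 = 2 * ((z i : ℕ) : ℝ) + 1 + 2 * (k * n) := by linarith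
          exact_mod_cast this
        omega
    · simp only [Set.mem_iUnion] at h
      obtain ⟨w, hw, y, hy, hyz⟩ := h
      suffices w = z from this ▸ hw
      funext i
      obtain ⟨k, hk⟩ := exists_int_of_toTorus_eq hyz i
      obtain ⟨h1, h2⟩ := (hy i).1 (Finset.mem_univ i)
      simp only [latticePoint] at h1 h2 hk
      have e1 : ((w i : ℕ) : ℤ) < (z i : ℕ) + k * n + 1 := by
        have : ((w i : ℕ) : ℝ) < (z i : ℕ) + k * n + 1 := by linarith
        exact_mod_cast this
      have e2 : ((z i : ℕ) : ℤ) + k * n < (w i : ℕ) + 1 := by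
        have : ((z i : ℕ) : ℝ) + k * n < (w i : ℕ) + 1 := by linarith
        exact_mod_cast this
      have hw := (w i).isLt
      have hz := (z i).isLt
      have hk0 : k = 0 := by
        have a1 : k < 1 := by
          by_contra! hk1
          nlinarith
        have a2 : -1 < k := by
          by_contra! hk1
          nlinarith
        omega
      subst hk0
      apply Fin.ext
      omega
  · exact fun y hy => Or.inr (Set.mem_iUnion₂.2 ⟨z, h, hy⟩)

theorem openCube_subset_plaquette_of_ne_univ {d n : ℕ} (x : (Fin d → Fin n) → ℝ)
    {S : Finset (Fin d)} (hS : S ≠ Finset.univ) (z : Fin d → Fin n) :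
    openCube S z ⊆ plaquette x :=
  (openCube_subset_cubeBoundary hS z).trans
    ((Set.subset_iUnion cubeBoundary z).trans Set.subset_union_left)

/-- All cubes of dimension less than `d` belong to the plaquette model, so the randomness of its
intrinsic volumes comes from the number of open `d`-cubes alone. -/
theorem intrinsicVolume_plaquette {d n : ℕ} (j : ℕ) (x : (Fin d → Fin n) → ℝ) :
    intrinsicVolume j (plaquette x) =
      (∑ S ∈ Finset.univ.erase (Finset.univ : Finset (Fin d)), ∑ _z : Fin d → Fin n,
        openCubeVolume j S.card) +
      openCubeVolume j d * ∑ z, ({1} : Set ℝ).indicator 1 (x z) := by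
  rw [intrinsicVolume, ← Finset.sum_erase_add _ _ (Finset.mem_univ Finset.univ)]
  congr 1
  · refine Finset.sum_congr rfl fun S hS => Finset.sum_congr rfl fun z _ => ?_
    rw [if_pos (openCube_subset_plaquette_of_ne_univ x (Finset.ne_of_mem_erase hS) z)]
  · rw [Finset.mul_sum]
    refine Finset.sum_congr rfl fun z _ => ?_
    simp [openCube_univ_subset_plaquette_iff, Set.indicator_apply]

end CubicalComplex

/-! ### Partial derivatives and restrictions to a line -/

theorem abs_sub_le_of_abs_hasDerivAt_le {f f' : ℝ → ℝ} {t C : ℝ}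
    (hf : ∀ s, HasDerivAt f (f' s) s) (hC : ∀ s, |s| ≤ |t| → |f' s| ≤ C) :
    |f t - f 0| ≤ C * |t| := by
  have hmem : ∀ s ∈ Set.uIcc 0 t, |s| ≤ |t| := fun s hs => by
    simpa using Set.abs_sub_left_of_mem_uIcc hs
  have := (convex_uIcc (0 : ℝ) t).norm_image_sub_le_of_norm_hasDerivWithin_le
    (fun s _ => (hf s).hasDerivWithinAt) (fun s hs => hC s (hmem s hs))
    Set.left_mem_uIcc Set.right_mem_uIcc
  simpa using this

/-- Increments along a coordinate direction, from the bound of the partial derivative minus a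
constant `c`. -/
theorem abs_sub_sub_le_of_partialDeriv {m : ℕ} {h : EuclideanSpace ℝ (Fin m) → ℝ} {i : Fin m}
    (hd : ∀ x, LineDifferentiableAt ℝ h x (EuclideanSpace.single i 1))
    (x : EuclideanSpace ℝ (Fin m)) (t c C : ℝ)
    (hC : ∀ s, |s| ≤ |t| →
      |partialDeriv i h (x + s • EuclideanSpace.single i 1) - c| ≤ C) :
    |h (x + t • EuclideanSpace.single i 1) - h x - t * c| ≤ C * |t| := by
  have key : ∀ s, HasDerivAt (fun s : ℝ => h (x + s • EuclideanSpace.single i 1) - s * c)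
      (partialDeriv i h (x + s • EuclideanSpace.single i 1) - c) s := fun s => by
    have h1 := (hd (x + s • EuclideanSpace.single i 1)).hasLineDerivAt
    have h2 : HasDerivAt (fun s : ℝ => h (x + s • EuclideanSpace.single i 1))
        (partialDeriv i h (x + s • EuclideanSpace.single i 1)) s := by
      have h3 := HasDerivAt.comp_sub_const s s (f := fun r : ℝ =>
        h (x + s • EuclideanSpace.single i 1 + r • EuclideanSpace.single i 1))
        (f' := partialDeriv i h (x + s • EuclideanSpace.single i 1))
        (by rw [sub_self]; exact h1)
      refine h3.congr_of_eventuallyEq (Filter.Eventually.of_forall fun r => ?_)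
      simp only [add_assoc, ← add_smul, add_sub_cancel]
    simpa using h2.fun_sub ((hasDerivAt_id s).mul_const c)
  have := abs_sub_le_of_abs_hasDerivAt_le key hC
  simpa [sub_right_comm] using this

theorem abs_sub_le_of_partialDeriv_le_one {m : ℕ} {h : EuclideanSpace ℝ (Fin m) → ℝ}
    (hd : ∀ i x, LineDifferentiableAt ℝ h x (EuclideanSpace.single i 1))
    (hb : ∀ i x, |partialDeriv i h x| ≤ 1) (x : EuclideanSpace ℝ (Fin m)) (c : Fin m → ℝ)
    (s : Finset (Fin m)) :
    |h (x + ∑ i ∈ s, c i • EuclideanSpace.single i 1) - h x| ≤ ∑ i ∈ s, |c i| := by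
  induction s using Finset.induction_on with
  | empty => simp
  | insert a s ha ih =>
    rw [Finset.sum_insert ha, Finset.sum_insert ha]
    have := abs_sub_sub_le_of_partialDeriv (hd a)
      (x + ∑ i ∈ s, c i • EuclideanSpace.single i 1) (c a) 0 1 (fun r _ => by simpa using hb a _)
    rw [mul_zero, sub_zero, one_mul, add_assoc, add_comm (∑ i ∈ s, _)] at this
    calc _ ≤ _ + _ := abs_sub_le _ (h (x + ∑ i ∈ s, c i • EuclideanSpace.single i 1)) _
      _ ≤ _ := add_le_add this ih

/-- First-order expansion of a function whose partial derivatives have partial derivatives bounded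
by `1`: the coordinates are changed one at a time. -/
theorem abs_sub_sub_sum_le {m : ℕ} {h : EuclideanSpace ℝ (Fin m) → ℝ}
    (hd : ∀ i x, LineDifferentiableAt ℝ h x (EuclideanSpace.single i 1))
    (hd' : ∀ i j x, LineDifferentiableAt ℝ (partialDeriv i h) x (EuclideanSpace.single j 1))
    (hb : ∀ i j x, |partialDeriv j (partialDeriv i h) x| ≤ 1)
    (x : EuclideanSpace ℝ (Fin m)) (c : Fin m → ℝ) (s : Finset (Fin m)) :
    |h (x + ∑ i ∈ s, c i • EuclideanSpace.single i 1) - h x - ∑ i ∈ s, c i * partialDeriv i h x| ≤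
      (∑ i ∈ s, |c i|) ^ 2 := by
  induction s using Finset.induction_on with
  | empty => simp
  | insert a s ha ih =>
    rw [Finset.sum_insert ha, Finset.sum_insert ha, Finset.sum_insert ha]
    set w := ∑ i ∈ s, c i • EuclideanSpace.single i (1 : ℝ) with hw
    have hS : 0 ≤ ∑ i ∈ s, |c i| := Finset.sum_nonneg fun i _ => abs_nonneg _
    -- Between `x` and the segment starting at `x + w` the partial derivative in direction `a`
    -- varies by at most the `ℓ¹` distance.
    have := abs_sub_sub_le_of_partialDeriv (hd a) (x + w) (c a) (partialDeriv a h x)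
      (|c a| + ∑ i ∈ s, |c i|) (fun r hr => by
        have h1 := abs_sub_le_of_partialDeriv_le_one (hd' a) (hb a) x c s
        have h2 := abs_sub_sub_le_of_partialDeriv (hd' a a) (x + w) r 0 1
          (fun r _ => by simpa using hb a a _)
        rw [mul_zero, sub_zero, one_mul] at h2
        calc _ ≤ _ + _ := abs_sub_le _ (partialDeriv a h (x + w)) _
          _ ≤ _ := add_le_add (h2.trans hr) h1)
    rw [add_assoc, add_comm w] at this
    have e : h (x + (c a • EuclideanSpace.single a 1 + w)) - h x -
        (c a * partialDeriv a h x + ∑ i ∈ s, c i * partialDeriv i h x) =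
        (h (x + (c a • EuclideanSpace.single a 1 + w)) - h (x + w) - c a * partialDeriv a h x) +
        (h (x + w) - h x - ∑ i ∈ s, c i * partialDeriv i h x) := by ring
    rw [e]
    refine (abs_add_le _ _).trans ((add_le_add this ih).trans ?_)
    nlinarith [abs_nonneg (c a)]

theorem EuclideanSpace.sum_smul_single {m : ℕ} (c : Fin m → ℝ) :
    ∑ i, c i • EuclideanSpace.single i (1 : ℝ) = WithLp.toLp 2 c := by
  ext j
  simp [Pi.single_apply]

theorem hasDerivAt_comp_smul {m : ℕ} {h : EuclideanSpace ℝ (Fin m) → ℝ}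
    (hd : ∀ i x, LineDifferentiableAt ℝ h x (EuclideanSpace.single i 1))
    (hd' : ∀ i j x, LineDifferentiableAt ℝ (partialDeriv i h) x (EuclideanSpace.single j 1))
    (hb : ∀ i j x, |partialDeriv j (partialDeriv i h) x| ≤ 1)
    (v : EuclideanSpace ℝ (Fin m)) (t : ℝ) :
    HasDerivAt (fun t : ℝ => h (t • v)) (∑ i, v i * partialDeriv i h (t • v)) t := by
  rw [hasDerivAt_iff_isLittleO_nhds_zero]
  have hO : (fun r : ℝ => h ((t + r) • v) - h (t • v) -
      r • ∑ i, v i * partialDeriv i h (t • v)) =O[nhds 0] fun r => r ^ 2 := by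
    refine Asymptotics.IsBigO.of_bound ((∑ i, |v i|) ^ 2) (Filter.Eventually.of_forall fun r => ?_)
    have := abs_sub_sub_sum_le hd hd' hb (t • v) (fun i => r * v i) Finset.univ
    rw [EuclideanSpace.sum_smul_single] at this
    have e : WithLp.toLp 2 (fun i => r * v i) = r • v := by ext; simp
    rw [e, ← add_smul] at this
    simp only [abs_mul, ← Finset.mul_sum, mul_assoc] at this
    simpa [mul_pow, mul_comm] using this
  exact hO.trans_isLittleO (by simpa using Asymptotics.isLittleO_pow_id (one_lt_two))

theorem abs_comp_smul_sub_le {m : ℕ} {h : EuclideanSpace ℝ (Fin m) → ℝ}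
    (hd : ∀ i x, LineDifferentiableAt ℝ h x (EuclideanSpace.single i 1))
    (hb : ∀ i x, |partialDeriv i h x| ≤ 1) (v : EuclideanSpace ℝ (Fin m)) (s t : ℝ) :
    |h (s • v) - h (t • v)| ≤ (∑ i, |v i|) * |s - t| := by
  have := abs_sub_le_of_partialDeriv_le_one hd hb (t • v) (fun i => (s - t) * v i) Finset.univ
  rw [EuclideanSpace.sum_smul_single] at this
  have e : WithLp.toLp 2 (fun i => (s - t) * v i) = (s - t) • v := by ext; simp
  rw [e, ← add_smul, add_sub_cancel] at this
  simpa only [abs_mul, ← Finset.mul_sum, mul_comm] using this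

theorem continuous_of_partialDeriv_le_one {m : ℕ} {h : EuclideanSpace ℝ (Fin m) → ℝ}
    (hd : ∀ i x, LineDifferentiableAt ℝ h x (EuclideanSpace.single i 1))
    (hb : ∀ i x, |partialDeriv i h x| ≤ 1) : Continuous h := by
  refine continuous_iff_continuousAt.2 fun x => ?_
  have hlim : Filter.Tendsto (fun y : EuclideanSpace ℝ (Fin m) => ∑ i, |y i - x i|)
      (nhds x) (nhds 0) := by
    have : Continuous fun y : EuclideanSpace ℝ (Fin m) => ∑ i, |y i - x i| := by fun_prop
    simpa using this.tendsto x
  refine tendsto_iff_dist_tendsto_zero.2 (squeeze_zero (fun _ => dist_nonneg) (fun y => ?_) hlim)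
  have := abs_sub_le_of_partialDeriv_le_one hd hb x (fun i => y i - x i) Finset.univ
  rw [EuclideanSpace.sum_smul_single] at this
  have e : x + WithLp.toLp 2 (fun i => y i - x i) = y := by ext; simp
  rwa [e] at this

/-- The regularity used by Lindeberg's argument: `f` is Lipschitz with constant `L`, its
derivative is `f₁`, and its second derivative `f₂` is Lipschitz with constant `M`. -/
structure HasLipschitzSecondDeriv (f f₁ f₂ : ℝ → ℝ) (L M : ℝ) : Prop where
  hasDerivAt : ∀ t, HasDerivAt f (f₁ t) t
  hasDerivAt' : ∀ t, HasDerivAt f₁ (f₂ t) t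
  lipschitz : ∀ s t, |f s - f t| ≤ L * |s - t|
  lipschitz' : ∀ s t, |f₂ s - f₂ t| ≤ M * |s - t|

namespace HasLipschitzSecondDeriv

variable {f f₁ f₂ : ℝ → ℝ} {L M : ℝ}

theorem comp_const_add (hf : HasLipschitzSecondDeriv f f₁ f₂ L M) (x : ℝ) :
    HasLipschitzSecondDeriv (fun y => f (x + y)) (fun y => f₁ (x + y)) (fun y => f₂ (x + y))
      L M where
  hasDerivAt t := (hf.hasDerivAt (x + t)).comp_const_add x t
  hasDerivAt' t := (hf.hasDerivAt' (x + t)).comp_const_add x t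
  lipschitz s t := by simpa using hf.lipschitz (x + s) (x + t)
  lipschitz' s t := by simpa using hf.lipschitz' (x + s) (x + t)

theorem continuous (hf : HasLipschitzSecondDeriv f f₁ f₂ L M) : Continuous f :=
  continuous_iff_continuousAt.2 fun t => (hf.hasDerivAt t).continuousAt

theorem nonneg (hf : HasLipschitzSecondDeriv f f₁ f₂ L M) : 0 ≤ M := by
  simpa using (abs_nonneg _).trans (hf.lipschitz' 1 0)

/-- The constant `1 / 6` is dropped, since only the order of the error matters. -/
theorem taylor_bound (hf : HasLipschitzSecondDeriv f f₁ f₂ L M) (t : ℝ) :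
    |f t - f 0 - f₁ 0 * t - f₂ 0 / 2 * t ^ 2| ≤ M * |t| ^ 3 := by
  have h1 : ∀ s, |f₁ s - f₁ 0 - f₂ 0 * s| ≤ M * |s| ^ 2 := fun s => by
    have := abs_sub_le_of_abs_hasDerivAt_le (f := fun s => f₁ s - f₂ 0 * s)
      (f' := fun s => f₂ s - f₂ 0) (t := s) (C := M * |s|)
      (fun r => by simpa using (hf.hasDerivAt' r).fun_sub ((hasDerivAt_id r).const_mul (f₂ 0)))
      (fun r hr => (hf.lipschitz' r 0).trans
        (by rw [sub_zero]; exact mul_le_mul_of_nonneg_left hr hf.nonneg))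
    rw [mul_zero, sub_zero, mul_assoc, ← sq] at this
    convert this using 2
    ring
  have := abs_sub_le_of_abs_hasDerivAt_le (f := fun s => f s - f₁ 0 * s - f₂ 0 / 2 * s ^ 2)
    (f' := fun s => f₁ s - f₁ 0 - f₂ 0 * s) (t := t) (C := M * |t| ^ 2)
    (fun r => by
      refine (((hf.hasDerivAt r).fun_sub ((hasDerivAt_id r).const_mul (f₁ 0))).fun_sub
        (((hasDerivAt_id r).fun_pow 2).const_mul (f₂ 0 / 2))).congr_deriv ?_
      simp
      ring)
    (fun r hr => (h1 r).trans (by gcongr; exact hf.nonneg))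
  rw [mul_assoc, ← pow_succ] at this
  convert this using 2
  ring

end HasLipschitzSecondDeriv

/-- Only derivatives up to the third order of the test function are needed. -/
theorem IsD4TestFunction.hasLipschitzSecondDeriv {m : ℕ} {g : EuclideanSpace ℝ (Fin m) → ℝ}
    (hg : IsD4TestFunction g) (v : EuclideanSpace ℝ (Fin m)) :
    HasLipschitzSecondDeriv (fun t => g (t • v))
      (fun t => ∑ i, v i * partialDeriv i g (t • v))
      (fun t => ∑ i, v i * ∑ j, v j * partialDeriv j (partialDeriv i g) (t • v))
      (∑ i, |v i|) ((∑ i, |v i|) ^ 3) := by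
  have d0 := hg.partiallyDifferentiable [] (by simp)
  have d1 := fun i => hg.partiallyDifferentiable [i] (by simp)
  have d2 := fun i j => hg.partiallyDifferentiable [j, i] (by simp)
  have b1 := fun i => hg.bound [i] (by simp) (by simp)
  have b2 := fun i j => hg.bound [j, i] (by simp) (by simp)
  have b3 := fun i j k => hg.bound [k, j, i] (by simp) (by simp)
  simp only [iteratedPartialDeriv, List.foldr] at d0 d1 d2 b1 b2 b3
  refine ⟨hasDerivAt_comp_smul d0 d1 b2 v, fun t => ?_, abs_comp_smul_sub_le d0 b1 v, fun s t => ?_⟩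
  · exact HasDerivAt.fun_sum fun i _ =>
      (hasDerivAt_comp_smul (d1 i) (d2 i) (b3 i) v t).const_mul (v i)
  · simp only [← Finset.sum_sub_distrib, ← mul_sub]
    have key : ∀ i j, |v j * (partialDeriv j (partialDeriv i g) (s • v) -
        partialDeriv j (partialDeriv i g) (t • v))| ≤ |v j| * ((∑ k, |v k|) * |s - t|) :=
      fun i j => by
        rw [abs_mul]
        exact mul_le_mul_of_nonneg_left (abs_comp_smul_sub_le (d2 i j) (b3 i j) v s t)
          (abs_nonneg _)
    calc _ ≤ ∑ i, |v i| * ∑ j, |v j| * ((∑ k, |v k|) * |s - t|) := by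
          refine (Finset.abs_sum_le_sum_abs _ _).trans (Finset.sum_le_sum fun i _ => ?_)
          rw [abs_mul]
          exact mul_le_mul_of_nonneg_left ((Finset.abs_sum_le_sum_abs _ _).trans
            (Finset.sum_le_sum fun j _ => key i j)) (abs_nonneg _)
      _ = _ := by
          rw [← Finset.sum_mul, ← Finset.sum_mul]
          ring

theorem IsD4TestFunction.continuous {m : ℕ} {g : EuclideanSpace ℝ (Fin m) → ℝ}
    (hg : IsD4TestFunction g) : Continuous g :=
  continuous_of_partialDeriv_le_one (hg.partiallyDifferentiable [] (by simp))
    (fun i => hg.bound [i] (by simp) (by simp))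

/-! ### Lindeberg's method on the real line -/

namespace HasLipschitzSecondDeriv

variable {f f₁ f₂ : ℝ → ℝ} {L M : ℝ}

theorem integrable (hf : HasLipschitzSecondDeriv f f₁ f₂ L M) {μ : Measure ℝ} [IsFiniteMeasure μ]
    (hμ : Integrable id μ) : Integrable f μ := by
  refine ((integrable_const |f 0|).add (hμ.abs.const_mul L)).mono'
    hf.continuous.aestronglyMeasurable (Filter.Eventually.of_forall fun x => ?_)
  have h1 := hf.lipschitz x 0
  have h2 := abs_sub_abs_le_abs_sub (f x) (f 0)
  simp only [sub_zero, Real.norm_eq_abs, Pi.add_apply, id] at *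
  linarith

/-- A second-order Taylor expansion shows that two laws with equal first and second moments
integrate `f` to values differing only by third absolute moments. -/
theorem abs_integral_sub_le (hf : HasLipschitzSecondDeriv f f₁ f₂ L M) {μ ν : Measure ℝ}
    [IsProbabilityMeasure μ] [IsProbabilityMeasure ν] (hμ : MemLp id 3 μ) (hν : MemLp id 3 ν)
    (h1 : ∫ x, x ∂μ = ∫ x, x ∂ν) (h2 : ∫ x, x ^ 2 ∂μ = ∫ x, x ^ 2 ∂ν) :
    |(∫ x, f x ∂μ) - ∫ x, f x ∂ν| ≤ M * ((∫ x, |x| ^ 3 ∂μ) + ∫ x, |x| ^ 3 ∂ν) := by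
  have key : ∀ {ρ : Measure ℝ} [IsProbabilityMeasure ρ], MemLp id 3 ρ →
      |(∫ x, f x ∂ρ) - (f 0 + f₁ 0 * (∫ x, x ∂ρ) + f₂ 0 / 2 * ∫ x, x ^ 2 ∂ρ)| ≤
        M * ∫ x, |x| ^ 3 ∂ρ := by
    intro ρ _ hρ
    have i1 : Integrable (fun x : ℝ => x) ρ := hρ.integrable (by norm_num)
    have i2 : Integrable (fun x : ℝ => x ^ 2) ρ :=
      (hρ.mono_exponent (by norm_num : (2 : ℝ≥0∞) ≤ 3)).integrable_sq
    have i3 : Integrable (fun x : ℝ => |x| ^ 3) ρ := by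
      simpa using hρ.integrable_norm_pow (by norm_num)
    have i0 : Integrable f ρ := hf.integrable i1
    have j1 : Integrable (fun x => f x - f 0) ρ := i0.sub (integrable_const _)
    have j2 : Integrable (fun x => f x - f 0 - f₁ 0 * x) ρ := j1.sub (i1.const_mul _)
    have e : (∫ x, f x ∂ρ) - (f 0 + f₁ 0 * (∫ x, x ∂ρ) + f₂ 0 / 2 * ∫ x, x ^ 2 ∂ρ) =
        ∫ x, f x - f 0 - f₁ 0 * x - f₂ 0 / 2 * x ^ 2 ∂ρ := by
      rw [integral_sub j2 (i2.const_mul _),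
        integral_sub j1 (i1.const_mul _),
        integral_sub i0 (integrable_const _), integral_const_mul, integral_const_mul]
      simp
      ring
    rw [e, ← integral_const_mul]
    refine (abs_integral_le_integral_abs).trans (integral_mono ?_ (i3.const_mul M)
      fun x => hf.taylor_bound x)
    exact (j2.sub (i2.const_mul _)).abs
  have k1 := key hμ
  have k2 := key hν
  rw [h1, h2] at k1
  rw [abs_sub_comm] at k2
  rw [mul_add]
  exact (abs_sub_le _ _ _).trans (add_le_add k1 k2)

theorem integrable_add_prod (hf : HasLipschitzSecondDeriv f f₁ f₂ L M) {μ ν : Measure ℝ}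
    [IsProbabilityMeasure μ] [IsProbabilityMeasure ν] (hμ : Integrable id μ)
    (hν : Integrable id ν) : Integrable (fun z : ℝ × ℝ => f (z.1 + z.2)) (μ.prod ν) := by
  have h : Integrable (fun z : ℝ × ℝ => z.1 + z.2) (μ.prod ν) :=
    (hμ.comp_fst ν).add (hν.comp_snd μ)
  refine (integrable_map_measure (f := fun z : ℝ × ℝ => z.1 + z.2)
    hf.continuous.aestronglyMeasurable (by fun_prop)).1 ?_
  have : IsProbabilityMeasure ((μ.prod ν).map fun z : ℝ × ℝ => z.1 + z.2) :=
    Measure.isProbabilityMeasure_map (by fun_prop)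
  exact hf.integrable ((integrable_map_measure (by fun_prop) (by fun_prop)).2 h)

/-- Replacing the two factors of a convolution one after the other. -/
theorem abs_integral_conv_sub_le (hf : HasLipschitzSecondDeriv f f₁ f₂ L M)
    {μ μ' ν ν' : Measure ℝ} [IsProbabilityMeasure μ] [IsProbabilityMeasure μ']
    [IsProbabilityMeasure ν] [IsProbabilityMeasure ν'] (hμ : Integrable id μ)
    (hμ' : Integrable id μ') (hν : Integrable id ν) (hν' : Integrable id ν') {A B : ℝ}
    (hA : ∀ y, |(∫ x, f (y + x) ∂μ) - ∫ x, f (y + x) ∂ν| ≤ A)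
    (hB : ∀ x, |(∫ y, f (x + y) ∂μ') - ∫ y, f (x + y) ∂ν'| ≤ B) :
    |(∫ x, f x ∂(μ ∗ μ')) - ∫ x, f x ∂(ν ∗ ν')| ≤ A + B := by
  have conv_eq : ∀ {ρ ρ' : Measure ℝ} [IsProbabilityMeasure ρ] [IsProbabilityMeasure ρ'],
      Integrable id ρ → Integrable id ρ' →
      ∫ x, f x ∂(ρ ∗ ρ') = ∫ x, ∫ y, f (x + y) ∂ρ' ∂ρ := fun h h' => by
    refine integral_conv ?_
    rw [Measure.conv, integrable_map_measure hf.continuous.aestronglyMeasurable (by fun_prop)]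
    exact hf.integrable_add_prod h h'
  have bound : ∀ {ρ : Measure ℝ} [IsProbabilityMeasure ρ] {u w : ℝ → ℝ} {D : ℝ},
      Integrable u ρ → Integrable w ρ → (∀ x, |u x - w x| ≤ D) →
      |(∫ x, u x ∂ρ) - ∫ x, w x ∂ρ| ≤ D := fun {ρ} _ {u w D} hu hw h => by
    rw [← integral_sub hu hw]
    simpa using norm_integral_le_of_norm_le_const (μ := ρ) (f := fun x => u x - w x)
      (Filter.Eventually.of_forall h)
  rw [conv_eq hμ hμ', conv_eq hν hν', add_comm A B]
  refine (abs_sub_le _ (∫ x, ∫ y, f (x + y) ∂ν' ∂μ) _).trans (add_le_add ?_ ?_)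
  · exact bound (hf.integrable_add_prod hμ hμ').integral_prod_left
      (hf.integrable_add_prod hμ hν').integral_prod_left hB
  · rw [integral_integral_swap (μ := μ) (f := fun x y => f (x + y)) (hf.integrable_add_prod hμ hν'),
      integral_integral_swap (μ := ν) (f := fun x y => f (x + y)) (hf.integrable_add_prod hν hν')]
    exact bound (hf.integrable_add_prod hμ hν').integral_prod_right
      (hf.integrable_add_prod hν hν').integral_prod_right
      fun y => by simpa only [add_comm] using hA y

/-- Lindeberg's replacement argument: the law of a sum of independent centred variables of
variance `v` is compared with that of as many independent Gaussians, one summand at a time. All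
translates of `f` satisfy the same bounds, which is what the induction rests on. -/
theorem abs_integral_sum_sub_gaussianReal_le {ι Ω : Type*} [MeasurableSpace Ω] {P : Measure Ω}
    [IsProbabilityMeasure P] {Y : ι → Ω → ℝ} (hY : ∀ i, Measurable (Y i)) (hind : iIndepFun Y P)
    (h3 : ∀ i, MemLp (Y i) 3 P) {v : NNReal} {A : ℝ} (hmean : ∀ i, ∫ ω, Y i ω ∂P = 0)
    (hvar : ∀ i, ∫ ω, Y i ω ^ 2 ∂P = v) (hA : ∀ i, ∫ ω, |Y i ω| ^ 3 ∂P ≤ A)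
    (s : Finset ι) {f f₁ f₂ : ℝ → ℝ} (hf : HasLipschitzSecondDeriv f f₁ f₂ L M) :
    |(∫ x, f x ∂(P.map (∑ i ∈ s, Y i))) - ∫ x, f x ∂(gaussianReal 0 (s.card • v))| ≤
      s.card * (M * (A + ∫ x, |x| ^ 3 ∂(gaussianReal 0 v))) := by
  classical
  induction s using Finset.induction_on generalizing f f₁ f₂ with
  | empty =>
    simp only [Finset.sum_empty, Finset.card_empty, zero_smul, gaussianReal_zero_var]
    have : P.map (0 : Ω → ℝ) = Measure.dirac 0 := by
      change P.map (fun _ => (0 : ℝ)) = _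
      rw [Measure.map_const]
      simp
    simp [this]
  | insert a s ha ih =>
    have hsum : ∀ u : Finset ι, Measurable (∑ i ∈ u, Y i) := fun u => by
      simpa only [← Finset.sum_fn] using Finset.measurable_sum u fun i _ => hY i
    have hmap : ∀ u : Finset ι, IsProbabilityMeasure (P.map (∑ i ∈ u, Y i)) := fun u =>
      Measure.isProbabilityMeasure_map (hsum u).aemeasurable
    have hmapa : IsProbabilityMeasure (P.map (Y a)) :=
      Measure.isProbabilityMeasure_map (hY a).aemeasurable
    have hlaw : P.map (∑ i ∈ insert a s, Y i) = P.map (Y a) ∗ P.map (∑ i ∈ s, Y i) := by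
      rw [Finset.sum_insert ha]
      exact ((hind.indepFun_finsetSum_of_notMem hY ha).symm).map_add_eq_map_conv_map
        (hY a) (hsum s)
    have hgauss : gaussianReal 0 ((insert a s).card • v) =
        gaussianReal 0 v ∗ gaussianReal 0 (s.card • v) := by
      rw [gaussianReal_conv_gaussianReal, Finset.card_insert_of_notMem ha, add_smul, one_smul,
        add_zero, add_comm]
    have hLp : MemLp id 3 (P.map (Y a)) :=
      (memLp_map_measure_iff aestronglyMeasurable_id (hY a).aemeasurable).2 (h3 a)
    have hgLp : ∀ w, MemLp id 3 (gaussianReal 0 w) := fun w => memLp_id_gaussianReal 3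
    have hgv : ∫ x, x ^ 2 ∂(gaussianReal 0 v) = v := by
      have := variance_fun_id_gaussianReal (μ := 0) (v := v)
      rw [variance_eq_integral (by fun_prop), integral_id_gaussianReal] at this
      simpa using this
    rw [hlaw, hgauss, Finset.card_insert_of_notMem ha, Nat.cast_succ, add_mul, one_mul]
    have hs : Integrable id (P.map (∑ i ∈ s, Y i)) :=
      (integrable_map_measure aestronglyMeasurable_id (hsum s).aemeasurable).2
        ((memLp_finsetSum' s fun i _ => h3 i).integrable (by norm_num))
    have hi : ∀ {ρ : Measure ℝ} [IsProbabilityMeasure ρ], MemLp id 3 ρ → Integrable id ρ :=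
      fun h => h.integrable (by norm_num)
    rw [add_comm]
    refine hf.abs_integral_conv_sub_le (hi hLp) hs (hi (hgLp _)) (hi (hgLp _)) (fun y => ?_)
      fun x => ih (hf.comp_const_add x)
    refine ((hf.comp_const_add y).abs_integral_sub_le hLp (hgLp v) ?_ ?_).trans ?_
    · rw [integral_id_gaussianReal, integral_map (hY a).aemeasurable (by fun_prop), hmean]
    · rw [hgv, integral_map (hY a).aemeasurable (by fun_prop), hvar]
    · rw [integral_map (hY a).aemeasurable (by fun_prop)]
      gcongr
      · exact hf.nonneg
      · exact hA a

end HasLipschitzSecondDeriv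

theorem integral_abs_pow_three_gaussianReal_mul {ε : ℝ} (hε : 0 ≤ ε) (s : NNReal) :
    ∫ x, |x| ^ 3 ∂(gaussianReal 0 (.mk (ε ^ 2) (sq_nonneg ε) * s)) =
      ε ^ 3 * ∫ x, |x| ^ 3 ∂(gaussianReal 0 s) := by
  have := gaussianReal_map_const_mul (μ := 0) (v := s) ε
  rw [mul_zero] at this
  rw [← this, integral_map (by fun_prop) (by fun_prop), ← integral_const_mul]
  simp only [abs_mul, mul_pow, abs_of_nonneg hε]

/-! ### The plaquette vector and its Gaussian limit -/

namespace CubicalComplex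

/-- The vector of the intrinsic volumes of an open `d`-cube. -/
noncomputable def openCubeVector (d : ℕ) : EuclideanSpace ℝ (Fin (d + 1)) :=
  WithLp.toLp 2 fun j => openCubeVolume j d

theorem limitCovariance_apply {d : ℕ} {p : ℝ} (i j : Fin (d + 1)) :
    limitCovariance d p i j = p * (1 - p) * (openCubeVector d i * openCubeVector d j) := by
  have hs : (-1 : ℝ) ^ (d - (i : ℕ)) * (-1) ^ (d - (j : ℕ)) = (-1) ^ ((i : ℕ) + (j : ℕ)) := by
    have hi : (i : ℕ) ≤ d := Nat.lt_succ_iff.1 i.isLt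
    have hj : (j : ℕ) ≤ d := Nat.lt_succ_iff.1 j.isLt
    rw [← pow_add, neg_one_pow_eq_pow_mod_two, neg_one_pow_eq_pow_mod_two (n := (i : ℕ) + j)]
    congr 1
    omega
  simp only [limitCovariance, Matrix.of_apply, openCubeVector, openCubeVolume, ← hs]
  ring

/-- The covariance matrix has rank one, so the Gaussian limit lives on a line. -/
theorem multivariateGaussian_limitCovariance (d : ℕ) {p : ℝ} (h0 : 0 < p) (h1 : p < 1) :
    multivariateGaussian 0 (limitCovariance d p) =
      (gaussianReal 0 (p * (1 - p)).toNNReal).map fun t => t • openCubeVector d := by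
  have hm : Measurable fun t : ℝ => t • openCubeVector d := by fun_prop
  have := Measure.isProbabilityMeasure_map (μ := gaussianReal 0 (p * (1 - p)).toNNReal)
    hm.aemeasurable
  refine Measure.ext_of_charFun (funext fun x => ?_)
  have hquad : x.ofLp ⬝ᵥ (limitCovariance d p).mulVec x.ofLp =
      p * (1 - p) * inner ℝ (openCubeVector d) x ^ 2 := by
    simp only [dotProduct, Matrix.mulVec, limitCovariance_apply, PiLp.inner_apply, sq,
      Finset.sum_mul_sum, RCLike.inner_apply, conj_trivial]
    simp only [Finset.mul_sum]
    exact Finset.sum_congr rfl fun i _ => Finset.sum_congr rfl fun j _ => by ring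
  rw [charFun_multivariateGaussian (limitCovariance_posSemidef d h0 h1), hquad, charFun_apply,
    integral_map hm.aemeasurable (by fun_prop)]
  have := charFun_gaussianReal (μ := 0) (v := (p * (1 - p)).toNNReal) (inner ℝ (openCubeVector d) x)
  rw [charFun_apply_real] at this
  rw [Real.coe_toNNReal _ (mul_nonneg h0.le (by linarith))] at this
  simp only [real_inner_smul_left, inner_zero_right, Complex.ofReal_mul, Complex.ofReal_pow,
    Complex.ofReal_zero, zero_mul, mul_comm (inner ℝ (openCubeVector d) x : ℂ)] at this ⊢
  rw [this]

/-- The rescaled centred indicator of the event that a `d`-cube is present, as a function of its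
sign. -/
noncomputable def centredSign (ε p t : ℝ) : ℝ := ε * (({1} : Set ℝ).indicator 1 t - p)

theorem measurable_centredSign (ε p : ℝ) : Measurable (centredSign ε p) := by
  unfold centredSign
  have : Measurable (({1} : Set ℝ).indicator (1 : ℝ → ℝ)) :=
    measurable_one.indicator (measurableSet_singleton 1)
  fun_prop

theorem abs_centredSign_le {ε p : ℝ} (hε : 0 ≤ ε) (h0 : 0 < p) (h1 : p < 1) (t : ℝ) :
    |centredSign ε p t| ≤ ε := by
  rw [centredSign, abs_mul, abs_of_nonneg hε]
  refine mul_le_of_le_one_right hε (abs_le.2 ?_)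
  by_cases ht : t = 1 <;> simp [ht] <;> constructor <;> linarith

section Moments

variable {Ω : Type*} [MeasurableSpace Ω] {P : Measure Ω} {X : Ω → ℝ} {p : ℝ}

theorem integrable_indicator_one_comp [IsProbabilityMeasure P] (hX : Measurable X) :
    Integrable (fun ω => ({1} : Set ℝ).indicator (1 : ℝ → ℝ) (X ω)) P :=
  (integrable_const (1 : ℝ)).mono' ((measurable_one.indicator
    (measurableSet_singleton 1)).comp hX).aestronglyMeasurable
    (Filter.Eventually.of_forall fun ω => by by_cases h : X ω = 1 <;> simp [h])

theorem integral_indicator_one_comp (hX : Measurable X) (hp : 0 ≤ p)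
    (h : P {ω | X ω = 1} = ENNReal.ofReal p) :
    ∫ ω, ({1} : Set ℝ).indicator (1 : ℝ → ℝ) (X ω) ∂P = p := by
  have e : (fun ω => ({1} : Set ℝ).indicator (1 : ℝ → ℝ) (X ω)) = {ω | X ω = 1}.indicator 1 := rfl
  have hm : MeasurableSet {ω | X ω = 1} := hX (measurableSet_singleton 1)
  rw [e, integral_indicator_one hm, measureReal_def, h, ENNReal.toReal_ofReal hp]

theorem integral_centredSign [IsProbabilityMeasure P] (hX : Measurable X) (hp : 0 ≤ p)
    (h : P {ω | X ω = 1} = ENNReal.ofReal p) (ε : ℝ) :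
    ∫ ω, centredSign ε p (X ω) ∂P = 0 := by
  simp only [centredSign]
  rw [integral_const_mul, integral_sub (integrable_indicator_one_comp hX) (integrable_const _),
    integral_indicator_one_comp hX hp h]
  simp

theorem integral_centredSign_sq [IsProbabilityMeasure P] (hX : Measurable X) (hp : 0 ≤ p)
    (h : P {ω | X ω = 1} = ENNReal.ofReal p) (ε : ℝ) :
    ∫ ω, centredSign ε p (X ω) ^ 2 ∂P = ε ^ 2 * (p * (1 - p)) := by
  have e : ∀ t, centredSign ε p t ^ 2 =
      ε ^ 2 * ((1 - 2 * p) * ({1} : Set ℝ).indicator 1 t + p ^ 2) := fun t => by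
    by_cases ht : t = 1 <;> simp [centredSign, ht] <;> ring
  simp only [e]
  rw [integral_const_mul, integral_add ((integrable_indicator_one_comp hX).const_mul _)
    (integrable_const _), integral_const_mul, integral_indicator_one_comp hX hp h]
  simp
  left
  ring

end Moments

/-- The centred and rescaled vector of intrinsic volumes is a multiple of a fixed vector. -/
theorem plaquetteVector_eq_smul {d n : ℕ} {Ω : Type*} [MeasurableSpace Ω] {P : Measure Ω}
    [IsProbabilityMeasure P] {X : (Fin d → Fin n) → Ω → ℝ} {p : ℝ} (hX : ∀ z, Measurable (X z))
    (hp : 0 ≤ p) (h : ∀ z, P {ω | X z ω = 1} = ENNReal.ofReal p) (ω : Ω) :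
    plaquetteVector P X ω =
      (∑ z, fun ω => centredSign ((n : ℝ) ^ (-(d : ℝ) / 2)) p (X z ω)) ω • openCubeVector d := by
  ext j
  simp only [plaquetteVector, intrinsicVolume_plaquette, openCubeVector, PiLp.smul_apply,
    smul_eq_mul, Finset.sum_apply, centredSign]
  rw [integral_add (integrable_const _) (Integrable.const_mul
    (integrable_finsetSum _ fun z _ => integrable_indicator_one_comp (hX z)) _),
    integral_const_mul, integral_finsetSum _ fun z _ => integrable_indicator_one_comp (hX z)]
  simp only [integral_indicator_one_comp (hX _) hp (h _)]
  rw [← Finset.mul_sum, Finset.sum_sub_distrib]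
  simp
  ring

end CubicalComplex

theorem mainTheorem6 (d : ℕ) (hd : 1 ≤ d) (p : ℝ) (hp0 : 0 < p) (hp1 : p < 1) :
    ∃ C : ℝ, ∀ n : ℕ, 3 ≤ n →
      ∀ (Ω : Type*) [MeasurableSpace Ω] (P : Measure Ω) [IsProbabilityMeasure P]
        (X : (Fin d → Fin n) → Ω → ℝ),
        (∀ z, Measurable (X z)) → iIndepFun X P →
        (∀ z, P {ω | X z ω = 1} = ENNReal.ofReal p) →
        (∀ z, P {ω | X z ω = -1} = ENNReal.ofReal (1 - p)) →
        d4Dist (P.map (CubicalComplex.plaquetteVector P X))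
            (multivariateGaussian 0 (CubicalComplex.limitCovariance d p)) ≤
          ENNReal.ofReal (C / (n : ℝ) ^ ((d : ℝ) / 2)) := by
  set s : NNReal := (p * (1 - p)).toNNReal
  have hs' : (s : ℝ) = p * (1 - p) := Real.coe_toNNReal _ (mul_nonneg hp0.le (by linarith))
  -- `(∑ i, |vᵢ|) ^ 3` bounds the Lipschitz constant of the second derivative of `t ↦ g (t • v)`.
  refine ⟨(∑ i, |CubicalComplex.openCubeVector d i|) ^ 3 * (1 + ∫ x, |x| ^ 3 ∂(gaussianReal 0 s)),
    fun n hn Ω _ P _ X hX hind h1 _ => iSup₂_le fun g hg => ENNReal.ofReal_le_ofReal ?_⟩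
  have hn0 : (0 : ℝ) < n := by
    have : 0 < n := by omega
    exact_mod_cast this
  set ε : ℝ := (n : ℝ) ^ (-(d : ℝ) / 2) with hε
  have hε0 : 0 ≤ ε := Real.rpow_nonneg hn0.le _
  have hεinv : ε = 1 / (n : ℝ) ^ ((d : ℝ) / 2) := by
    rw [hε, neg_div, Real.rpow_neg hn0.le, one_div]
  -- The scaling is such that the `n ^ d` summands have total variance `p * (1 - p)`.
  have hcard : (n : ℝ) ^ d * ε ^ 2 = 1 := by
    rw [hε, ← Real.rpow_natCast, ← Real.rpow_natCast, ← Real.rpow_mul hn0.le, ← Real.rpow_add hn0]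
    convert Real.rpow_zero (n : ℝ) using 2
    push_cast
    ring
  set Y : (Fin d → Fin n) → Ω → ℝ := fun z ω => CubicalComplex.centredSign ε p (X z ω)
  have hY : ∀ z, Measurable (Y z) := fun z =>
    (CubicalComplex.measurable_centredSign ε p).comp (hX z)
  have hYind : iIndepFun Y P := hind.comp (fun _ => CubicalComplex.centredSign ε p) fun _ =>
    CubicalComplex.measurable_centredSign ε p
  have hYb : ∀ z ω, |Y z ω| ≤ ε := fun z ω => CubicalComplex.abs_centredSign_le hε0 hp0 hp1 _
  have hYLp : ∀ z, MemLp (Y z) 3 P := fun z =>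
    MemLp.of_bound (hY z).aestronglyMeasurable ε (Filter.Eventually.of_forall (hYb z))
  have hY3 : ∀ z, ∫ ω, |Y z ω| ^ 3 ∂P ≤ ε ^ 3 := fun z => by
    have := norm_integral_le_of_norm_le_const (μ := P) (f := fun ω => |Y z ω| ^ 3) (C := ε ^ 3)
      (Filter.Eventually.of_forall fun ω => by
        simpa using pow_le_pow_left₀ (abs_nonneg _) (hYb z ω) 3)
    simpa using (le_abs_self _).trans this
  have hYvar : ∀ z, ∫ ω, Y z ω ^ 2 ∂P = (NNReal.mk (ε ^ 2) (sq_nonneg ε) * s : NNReal) :=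
    fun z => by
    rw [NNReal.coe_mul, NNReal.coe_mk, hs']
    exact CubicalComplex.integral_centredSign_sq (hX z) hp0.le (h1 z) ε
  have hsum : Measurable (∑ z, Y z) := by
    simpa only [← Finset.sum_fn] using Finset.measurable_sum Finset.univ fun z _ => hY z
  have hv : Measurable fun t : ℝ => t • CubicalComplex.openCubeVector d := by fun_prop
  have hW : P.map (CubicalComplex.plaquetteVector P X) =
      (P.map (∑ z, Y z)).map fun t => t • CubicalComplex.openCubeVector d := by
    rw [Measure.map_map hv hsum]
    exact congrArg (Measure.map · P) (funext (CubicalComplex.plaquetteVector_eq_smul hX hp0.le h1))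
  have hs2 : (Finset.univ : Finset (Fin d → Fin n)).card •
      (NNReal.mk (ε ^ 2) (sq_nonneg ε) * s) = s := by
    apply NNReal.eq
    simp only [Finset.card_univ, Fintype.card_fun, Fintype.card_fin, nsmul_eq_mul,
      NNReal.coe_mul, NNReal.coe_mk, NNReal.coe_natCast, Nat.cast_pow, ← mul_assoc,
      NNReal.coe_pow, hcard, one_mul]
  have key := HasLipschitzSecondDeriv.abs_integral_sum_sub_gaussianReal_le hY hYind hYLp
    (fun z => CubicalComplex.integral_centredSign (hX z) hp0.le (h1 z) ε)
    hYvar hY3 Finset.univ (hg.hasLipschitzSecondDeriv (CubicalComplex.openCubeVector d))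
  rw [hs2, integral_abs_pow_three_gaussianReal_mul hε0] at key
  have hgm : ∀ {ρ : Measure (EuclideanSpace ℝ (Fin (d + 1)))}, AEStronglyMeasurable g ρ :=
    hg.continuous.aestronglyMeasurable
  rw [hW, CubicalComplex.multivariateGaussian_limitCovariance d hp0 hp1,
    integral_map hv.aemeasurable hgm, integral_map hv.aemeasurable hgm]
  refine key.trans_eq ?_
  rw [div_eq_mul_one_div, ← hεinv]
  simp only [Finset.card_univ, Fintype.card_fun, Fintype.card_fin, Nat.cast_pow]
  linear_combination (∑ i, |CubicalComplex.openCubeVector d i|) ^ 3 *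
    (1 + ∫ x, |x| ^ 3 ∂(gaussianReal 0 s)) * ε * hcard
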